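/- Let $\mathbb{H}$ be a nonzero finite-dimensional complex Hilbert space (for instance $(\mathbb{C}^2)^{\otimes N}$), and let $c_1,\dots,c_N$ be operators on $\mathbb{H}$ which, together with their adjoints, satisfy the canonical anti-commutation relations $$c_ic_j+c_jc_i=0,\qquad c_i^*c_j^*+c_j^*c_i^*=0,\qquad c_ic_j^*+c_j^*c_i=\delta_{ij}\,\mathbb{I}\qquad(1\le i,j\le N).$$ Let $\mathbf{M},\boldsymbol{\Delta}\in\mathbb{C}^{N\times N}$ with $\mathbf{M}=\mathbf{M}^*$ and $\boldsymbol{\Delta}^\top=-\boldsymbol{\Delta}$, and let $$H_{\mathrm{BdG}}=\frac12\sum_{i,j=1}^N\mathbf{M}_{ij}\,(c_i^*c_j-c_jc_i^*)+\frac12\sum_{i,j=1}^N\left(\boldsymbol{\Delta}_{ij}\,c_i^*c_j^*-\overline{\boldsymbol{\Delta}_{ij}}\,c_ic_j\right)$$ be the Bogoliubov–de Gennes Hamiltonian. Let $\beta>0$, let $\rho=Z^{-1}\exp(-\beta H_{\mathrm{BdG}})$ with $Z=\operatorname{tr}\exp(-\beta H_{\mathrm{BdG}})$, and write $\langle A\rangle_\rho=\operatorname{tr}(\rho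 A)$ and $N_i=c_i^*c_i$. For $1\le i,j\le N$ set $\mathbf{K}_{ij}=\langle c_i^*c_j\rangle_\rho$, $\mathbf{P}_{ij}=\langle c_i^*c_j^*\rangle_\rho$ and $$\mathbb{K}(i,j)=\begin{pmatrix}\mathbf{P}_{ij}&\mathbf{K}_{ij}\\-\mathbf{K}_{ji}&-\overline{\mathbf{P}_{ij}}\end{pmatrix}.$$ Then, for every $k\ge 0$ and all pairwise distinct $i_1,\dots,i_k\in\{1,\dots,N\}$, $$\langle N_{i_1}\cdots N_{i_k}\rangle_\rho=\mathrm{Pf}\bigl(\mathbb{K}(i_m,i_n)\bigr)_{1\le m,n\le k},$$ where the right-hand side is the Pfaffian of the $2k\times 2k$ matrix with $2\times2$ blocks $\mathbb{K}(i_m,i_n)$, the Pfaffian of a $2k\times2k$ matrix being $\mathrm{Pf}(A)=\frac{1}{2^kk!}\sum_{\sigma\in\mathfrak{S}_{2k}}\mathrm{sgn}(\sigma)\prod_{l=1}^kA_{\sigma(2l-1)\,\sigma(2l)}$. Moreover, $\mathbb{K}(i,j)^\top=-\mathbb{K}(j,i)$ for all $1\le i,j\le N$. -/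

import Mathlib

open scoped Matrix ComplexConjugate Nat

/-- The Pfaffian of a complex matrix of even size `2k`, with rows and columns indexed by `0, …, 2k-1`:
`(2^k k!)⁻¹ ∑_σ sgn(σ) ∏_{l < k} A (σ (2l)) (σ (2l+1))`.
Here `finProdFinEquiv (l, r)` is the index `2 l + r`. -/
noncomputable def pfaffian {k : ℕ} (A : Matrix (Fin (k * 2)) (Fin (k * 2)) ℂ) : ℂ :=
  ((2 : ℂ) ^ k * (k ! : ℂ))⁻¹ *
    ∑ σ : Equiv.Perm (Fin (k * 2)), ((Equiv.Perm.sign σ : ℤ) : ℂ) *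
      ∏ l : Fin k, A (σ (finProdFinEquiv (l, 0))) (σ (finProdFinEquiv (l, 1)))

/-- The `2k × 2k` matrix whose `(m, n)` block of size `2 × 2` is `B m n`:
its entry at `(2m + r, 2n + s)` is `B m n r s`. -/
def blockMatrix {k : ℕ} (B : Fin k → Fin k → Matrix (Fin 2) (Fin 2) ℂ) :
    Matrix (Fin (k * 2)) (Fin (k * 2)) ℂ :=
  Matrix.of fun a b => B a.divNat b.divNat a.modNat b.modNat

section Fermions

variable {E : Type*} [NormedAddCommGroup E] [InnerProductSpace ℂ E] [CompleteSpace E] {N : ℕ}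

/-- The canonical anti-commutation relations for the operators `c_1, …, c_N` and their adjoints. -/
structure IsCAR (c : Fin N → (E →L[ℂ] E)) : Prop where
  annihilation : ∀ i j, c i * c j + c j * c i = 0
  creation : ∀ i j, star (c i) * star (c j) + star (c j) * star (c i) = 0
  mixed : ∀ i j, c i * star (c j) + star (c j) * c i = if i = j then 1 else 0

/-- The number operator `N_i = c_i^* c_i`. -/
noncomputable def numberOp (c : Fin N → (E →L[ℂ] E)) (i : Fin N) : E →L[ℂ] E :=
  star (c i) * c i

/-- The Bogoliubov–de Gennes Hamiltonian
`½ ∑ M_ij (c_i^* c_j - c_j c_i^*) + ½ ∑ (Δ_ij c_i^* c_j^* - conj(Δ_ij) c_i c_j)`. -/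
noncomputable def bdgHamiltonian (c : Fin N → (E →L[ℂ] E)) (M Δ : Matrix (Fin N) (Fin N) ℂ) :
    E →L[ℂ] E :=
  (1 / 2 : ℂ) • ∑ i, ∑ j, M i j • (star (c i) * c j - c j * star (c i)) +
    (1 / 2 : ℂ) • ∑ i, ∑ j,
      (Δ i j • (star (c i) * star (c j)) - conj (Δ i j) • (c i * c j))

/-- The trace of an operator (used in finite dimension only). -/
noncomputable def opTrace (A : E →L[ℂ] E) : ℂ :=
  LinearMap.trace ℂ E (A : E →ₗ[ℂ] E)

/-- The thermal state `Z⁻¹ exp(-β H)`, where `Z = tr exp(-β H)`. -/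
noncomputable def thermalState (β : ℝ) (H : E →L[ℂ] E) : E →L[ℂ] E :=
  (opTrace (NormedSpace.exp ((-β : ℂ) • H)))⁻¹ • NormedSpace.exp ((-β : ℂ) • H)

/-- The expectation value `⟨A⟩_ρ = tr (ρ A)`. -/
noncomputable def expectation (ρ A : E →L[ℂ] E) : ℂ :=
  opTrace (ρ * A)

/-- The matrix `K_ij = ⟨c_i^* c_j⟩_ρ`. -/
noncomputable def matK (ρ : E →L[ℂ] E) (c : Fin N → (E →L[ℂ] E)) : Matrix (Fin N) (Fin N) ℂ :=
  Matrix.of fun i j => expectation ρ (star (c i) * c j)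

/-- The matrix `P_ij = ⟨c_i^* c_j^*⟩_ρ`. -/
noncomputable def matP (ρ : E →L[ℂ] E) (c : Fin N → (E →L[ℂ] E)) : Matrix (Fin N) (Fin N) ℂ :=
  Matrix.of fun i j => expectation ρ (star (c i) * star (c j))

/-- The `2 × 2`-matrix-valued kernel `[[P_ij, K_ij], [-K_ji, -conj(P_ij)]]`. -/
noncomputable def pfKernel (ρ : E →L[ℂ] E) (c : Fin N → (E →L[ℂ] E)) (i j : Fin N) :
    Matrix (Fin 2) (Fin 2) ℂ :=
  !![matP ρ c i j, matK ρ c i j; -(matK ρ c j i), -conj (matP ρ c i j)]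

end Fermions

/-! The Gibbs state is quasi-free, and this can be proved without diagonalizing `H`. Let `V` be the
span of all `c_i`, `c_i^*`. Anticommutators in `V` are scalar, so the commutator with the quadratic
`H` preserves `V`, and hence so does conjugation by `exp (βH)`. Each `a ∈ V` can then be written `a
= d + d'` with `d' = exp (βH) d exp (-βH)`, because `1 + Ad` is injective on the finite-dimensional
`V`; cyclicity of the trace gives `ω(x d) = ω(d' x)`. Anticommuting `d` through an odd product of
fields and returning it as `d'` yields Wick's recursion (`wick_recursion`).

The same recursion is the expansion of a Pfaffian along its first row (`pfaffianSum_succ`). It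
remains to read `N_{i_1} ⋯ N_{i_k}` as a product of `2k` fields whose ordered two-point functions
are the entries above the diagonal of the block matrix. -/

/-! ### Sums over permutations, by cosets of a point stabilizer -/

section PermutationSums

open Equiv

/-- A sum over the permutations of `Fin (n + 1)`, grouped by the image of `0`, for any choice of
coset representatives of the stabilizer of `0`. -/
theorem sum_perm_fin_succ {R : Type*} [AddCommMonoid R] {n : ℕ}
    (τ : Fin (n + 1) → Perm (Fin (n + 1))) (hτ : ∀ p, τ p 0 = p) (f : Perm (Fin (n + 1)) → R) :
    ∑ σ, f σ = ∑ p, ∑ e : Perm (Fin n), f (τ p * Perm.decomposeFin.symm (0, e)) := by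
  rw [← Finset.sum_product', Finset.univ_product_univ]
  symm
  refine Fintype.sum_bijective (fun x : Fin (n + 1) × Perm (Fin n) =>
    τ x.1 * Perm.decomposeFin.symm (0, x.2)) ?_ _ _ fun _ => rfl
  rw [Fintype.bijective_iff_injective_and_card]
  constructor
  · rintro ⟨p, e⟩ ⟨q, f⟩ h
    have hpq : p = q := by
      have := congrArg (fun σ : Perm (Fin (n + 1)) => σ 0) h
      simpa [hτ] using this
    subst hpq
    have := Perm.decomposeFin.symm.injective (mul_left_cancel h)
    simpa using this
  · simp [Fintype.card_perm, Nat.factorial_succ]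

theorem decomposeFin_symm_zero_inv {n : ℕ} (e : Perm (Fin n)) :
    (Perm.decomposeFin.symm (0, e) : Perm (Fin (n + 1)))⁻¹ = Perm.decomposeFin.symm (0, e⁻¹) := by
  rw [inv_eq_iff_mul_eq_one]
  ext x
  refine Fin.cases ?_ (fun x => ?_) x <;> simp

end PermutationSums

/-! ### Pfaffian and its expansion along the first row -/

section Pfaffian

open Equiv

/-- The position `2 l + r` among `n = 2 k` positions. -/
def pairIndex {n k : ℕ} (h : n = k * 2) : Fin k × Fin 2 ≃ Fin n :=
  finProdFinEquiv.trans (finCongr h.symm)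

theorem pairIndex_zero_zero {n k : ℕ} (h : n + 2 = (k + 1) * 2) : pairIndex h (0, 0) = 0 := by
  ext; simp [pairIndex, finProdFinEquiv]

theorem pairIndex_zero_one {n k : ℕ} (h : n + 2 = (k + 1) * 2) :
    pairIndex h (0, 1) = Fin.succ 0 := by
  ext; simp [pairIndex, finProdFinEquiv]

theorem pairIndex_succ {n k : ℕ} (h : n = k * 2) (h' : n + 2 = (k + 1) * 2) (l : Fin k)
    (r : Fin 2) : pairIndex h' (l.succ, r) = (pairIndex h (l, r)).succ.succ := by
  ext; simp [pairIndex, finProdFinEquiv]; ring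

/-- The contribution of a permutation to the Pfaffian. -/
def pfaffianTerm {n k : ℕ} (h : n = k * 2) (A : Matrix (Fin n) (Fin n) ℂ) (σ : Perm (Fin n)) : ℂ :=
  ((Perm.sign σ : ℤ) : ℂ) * ∏ l : Fin k, A (σ (pairIndex h (l, 0))) (σ (pairIndex h (l, 1)))

/-- The unnormalized Pfaffian. -/
def pfaffianSum {n k : ℕ} (h : n = k * 2) (A : Matrix (Fin n) (Fin n) ℂ) : ℂ :=
  ∑ σ, pfaffianTerm h A σ

theorem pfaffian_eq_pfaffianSum {k : ℕ} (A : Matrix (Fin (k * 2)) (Fin (k * 2)) ℂ) :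
    pfaffian A = ((2 : ℂ) ^ k * (k ! : ℂ))⁻¹ * pfaffianSum rfl A := rfl

/-- Permuting whole pairs moves both members alike, so its sign is a square, and it only reorders
the factors. -/
theorem pfaffianTerm_mul_pairPerm {n k : ℕ} (h : n = k * 2) (A : Matrix (Fin n) (Fin n) ℂ)
    (σ : Perm (Fin n)) (π : Perm (Fin k)) :
    pfaffianTerm h A (σ * (pairIndex h).permCongr (prodCongrLeft fun _ => π)) =
      pfaffianTerm h A σ := by
  have hs : Perm.sign ((pairIndex h).permCongr (prodCongrLeft fun _ : Fin 2 => π)) = 1 := by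
    rw [Perm.sign_permCongr, Perm.sign_prodCongrLeft]
    simp
  unfold pfaffianTerm
  rw [Perm.sign_mul, hs, mul_one]
  congr 1
  rw [← Equiv.prod_comp π (fun l => A (σ (pairIndex h (l, 0))) (σ (pairIndex h (l, 1))))]
  simp [prodCongrLeft]

/-- The sign of the transposition cancels the sign from antisymmetry of `A`. -/
theorem pfaffianTerm_mul_swap {n k : ℕ} (h : n = k * 2) (A : Matrix (Fin n) (Fin n) ℂ)
    (hA : ∀ p q, A q p = -A p q) (σ : Perm (Fin n)) (m : Fin k) :
    pfaffianTerm h A (σ * swap (pairIndex h (m, 0)) (pairIndex h (m, 1))) =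
      pfaffianTerm h A σ := by
  unfold pfaffianTerm
  have hne : pairIndex h (m, 0) ≠ pairIndex h (m, 1) := by simp
  have hp : ∀ l : Fin k,
      A ((σ * swap (pairIndex h (m, 0)) (pairIndex h (m, 1))) (pairIndex h (l, 0)))
        ((σ * swap (pairIndex h (m, 0)) (pairIndex h (m, 1))) (pairIndex h (l, 1))) =
      (if l = m then -1 else 1) * A (σ (pairIndex h (l, 0))) (σ (pairIndex h (l, 1))) := by
    intro l
    by_cases hl : l = m
    · subst hl
      simp [hA (σ (pairIndex h (l, 0)))]
    · rw [Perm.mul_apply, Perm.mul_apply, swap_apply_of_ne_of_ne, swap_apply_of_ne_of_ne] <;>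
        simp [hl]
  rw [Finset.prod_congr rfl fun l _ => hp l, Finset.prod_mul_distrib, Finset.prod_ite_eq',
    Perm.sign_mul, Perm.sign_swap hne]
  simp

/-- Expansion of the Pfaffian along the first row. -/
theorem pfaffianSum_succ {n k : ℕ} (h : n = k * 2) (h' : n + 2 = (k + 1) * 2)
    (A : Matrix (Fin (n + 2)) (Fin (n + 2)) ℂ) (hA : ∀ p q, A q p = -A p q) :
    pfaffianSum h' A = 2 * (k + 1 : ℂ) * ∑ j : Fin (n + 1), (-1) ^ (j : ℕ) * A 0 j.succ *
      pfaffianSum h (A.submatrix (fun x => (j.succAbove x).succ) fun x => (j.succAbove x).succ) := by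
  -- The symmetries of the pairing act transitively on positions, so coset representatives can be
  -- chosen that leave every term unchanged.
  have hrep : ∀ p : Fin (n + 2), ∃ τ : Perm (Fin (n + 2)), τ 0 = p ∧
      ∀ σ, pfaffianTerm h' A (σ * τ) = pfaffianTerm h' A σ := by
    intro p
    obtain ⟨⟨l, r⟩, rfl⟩ := (pairIndex h').surjective p
    fin_cases r
    · refine ⟨(pairIndex h').permCongr (prodCongrLeft fun _ => swap 0 l), ?_,
        fun σ => pfaffianTerm_mul_pairPerm h' A σ _⟩
      rw [← pairIndex_zero_zero h']
      simp [prodCongrLeft]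
    · refine ⟨(pairIndex h').permCongr (prodCongrLeft fun _ => swap 0 l) *
        swap (pairIndex h' (0, 0)) (pairIndex h' (0, 1)), ?_, fun σ => ?_⟩
      · rw [← pairIndex_zero_zero h']
        simp [prodCongrLeft]
      · rw [← mul_assoc, pfaffianTerm_mul_swap h' A hA, pfaffianTerm_mul_pairPerm]
  choose τ hτ0 hτ using hrep
  have hτinv : ∀ p σ, pfaffianTerm h' A (σ * (τ p)⁻¹) = pfaffianTerm h' A σ := fun p σ => by
    rw [← hτ p (σ * (τ p)⁻¹), inv_mul_cancel_right]
  -- Passing to inverses puts the representatives on the right, where they drop out: all `n + 2`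
  -- cosets contribute equally.
  have hstab : pfaffianSum h' A =
      (n + 2 : ℂ) * ∑ e : Perm (Fin (n + 1)), pfaffianTerm h' A (Perm.decomposeFin.symm (0, e)) := by
    unfold pfaffianSum
    rw [← Equiv.sum_comp (Equiv.inv _), sum_perm_fin_succ τ hτ0]
    simp only [Equiv.inv_apply, mul_inv_rev, hτinv, decomposeFin_symm_zero_inv]
    rw [Finset.sum_const, ← Equiv.sum_comp (Equiv.inv (Perm (Fin (n + 1))))]
    simp [add_assoc]
  have hn : (n : ℂ) + 2 = 2 * (k + 1) := by
    rw [h]; push_cast; ring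
  -- Now group by the partner `j` of index `0`. The inverse cycle has sign `(-1)^j` and acts as
  -- `j.succAbove` on the rest.
  rw [hstab, hn, sum_perm_fin_succ (fun j => j.cycleRange.symm) fun j => Fin.cycleRange_symm_zero j]
  congr 1
  refine Finset.sum_congr rfl fun j _ => ?_
  unfold pfaffianSum
  rw [Finset.mul_sum]
  refine Finset.sum_congr rfl fun e _ => ?_
  unfold pfaffianTerm
  rw [Fin.prod_univ_succ, pairIndex_zero_zero, pairIndex_zero_one]
  simp only [pairIndex_succ h h', Perm.decomposeFin.symm_sign, Perm.sign_mul, Perm.sign_symm,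
    Fin.sign_cycleRange, Perm.decomposeFin_symm_apply_succ, Perm.decomposeFin_symm_apply_zero,
    Perm.mul_apply, swap_self, Equiv.refl_apply, Fin.cycleRange_symm_succ,
    Fin.cycleRange_symm_zero, Matrix.submatrix_apply, if_true, one_mul]
  push_cast
  ring

end Pfaffian

/-! ### Wick's recursion and its Pfaffian solution -/

section Wick

/-- Moving an element to the right through a product, when all anticommutators are scalar. -/
theorem mul_prod_ofFn_eq_of_anticomm {A : Type*} [Ring A] [Algebra ℂ A] (V : Set A)
    (g : A → A → ℂ) (hg : ∀ a ∈ V, ∀ b ∈ V, a * b + b * a = g a b • (1 : A)) {a : A} (ha : a ∈ V)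
    (m : ℕ) (b : Fin (m + 1) → A) (hb : ∀ j, b j ∈ V) :
    a * (List.ofFn b).prod =
      ∑ j : Fin (m + 1), ((-1) ^ (j : ℕ) * g a (b j)) • (List.ofFn fun x => b (j.succAbove x)).prod +
        (-1 : ℂ) ^ (m + 1) • ((List.ofFn b).prod * a) := by
  have swap : ∀ j, a * b j = g a (b j) • (1 : A) - b j * a := fun j =>
    eq_sub_of_add_eq (hg a ha _ (hb j))
  induction m with
  | zero => simp [swap]; abel
  | succ m ih =>
    have ih' := ih (fun x => b x.succ) (fun j => hb _) (fun j => swap _)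
    rw [List.ofFn_succ, List.prod_cons, ← mul_assoc, swap, sub_mul, mul_assoc, ih', mul_add,
      Fin.sum_univ_succ (n := m + 1), Finset.mul_sum]
    simp only [List.ofFn_succ, List.prod_cons, Fin.succ_succAbove_zero, Fin.succ_succAbove_succ,
      Fin.succAbove_zero, mul_smul_comm, smul_mul_assoc, one_mul, Fin.val_zero, pow_zero,
      Fin.val_succ, pow_succ, mul_neg, mul_one, neg_mul, neg_smul, Finset.sum_neg_distrib,
      mul_assoc, neg_neg]
    abel

/-- Wick's recursion for a functional satisfying a Kubo–Martin–Schwinger condition. -/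
theorem wick_recursion {A : Type*} [Ring A] [Algebra ℂ A] (V : Set A)
    (g : A → A → ℂ) (hg : ∀ a ∈ V, ∀ b ∈ V, a * b + b * a = g a b • (1 : A)) (ω : A →ₗ[ℂ] ℂ)
    (h1 : ω 1 = 1)
    (hω : ∀ a ∈ V, ∃ d ∈ V, ∃ d', d + d' = a ∧ ∀ x, ω (x * d) = ω (d' * x))
    {a : A} (ha : a ∈ V) {m : ℕ} (hm : Even m) (b : Fin (m + 1) → A) (hb : ∀ j, b j ∈ V) :
    ω (a * (List.ofFn b).prod) = ∑ j : Fin (m + 1), (-1) ^ (j : ℕ) * ω (a * b j) *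
      ω (List.ofFn fun x => b (j.succAbove x)).prod := by
  obtain ⟨d, hd, d', rfl, hdd⟩ := hω a ha
  have h2 : ∀ j, ω ((d + d') * b j) = g d (b j) := fun j => by
    rw [add_mul, map_add, ← hdd, ← map_add, hg d hd _ (hb j), map_smul, h1, smul_eq_mul, mul_one]
  -- `m + 1` is odd, so moving `d` to the far right gives minus the term obtained from `d'`, and the
  -- two cancel.
  rw [add_mul, map_add, ← hdd, mul_prod_ofFn_eq_of_anticomm V g hg hd m b hb, hm.add_one.neg_one_pow]
  simp [h2]

/-- Wick's theorem in Pfaffian form. -/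
theorem pfaffianSum_eq_of_wick {A : Type*} [Ring A] [Algebra ℂ A] (V : Set A) (ω : A → ℂ)
    (h1 : ω 1 = 1)
    (hW : ∀ a ∈ V, ∀ (m : ℕ) (b : Fin (m + 1) → A), Even m → (∀ j, b j ∈ V) →
      ω (a * (List.ofFn b).prod) = ∑ j : Fin (m + 1), (-1) ^ (j : ℕ) * ω (a * b j) *
        ω (List.ofFn fun x => b (j.succAbove x)).prod)
    (k n : ℕ) (h : n = k * 2) (b : Fin n → A) (hb : ∀ p, b p ∈ V) (B : Matrix (Fin n) (Fin n) ℂ)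
    (hB : ∀ p q, B q p = -B p q) (hBω : ∀ p q, p < q → B p q = ω (b p * b q)) :
    pfaffianSum h B = (2 ^ k * k ! : ℂ) * ω (List.ofFn b).prod := by
  induction k generalizing n with
  | zero =>
    obtain rfl : n = 0 := by simpa using h
    simp [pfaffianSum, pfaffianTerm, h1]
  | succ k ih =>
    obtain ⟨n, rfl⟩ : ∃ m, n = m + 2 := ⟨k * 2, by omega⟩
    have h0 : n = k * 2 := by omega
    rw [pfaffianSum_succ h0 h B hB, List.ofFn_succ, List.prod_cons,
      hW _ (hb 0) n _ (by rw [h0]; simp) fun j => hb _, Finset.mul_sum, Finset.mul_sum]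
    refine Finset.sum_congr rfl fun j _ => ?_
    rw [ih n h0 (fun x => b (j.succAbove x).succ) (fun p => hb _)
      (B.submatrix (fun x => (j.succAbove x).succ) fun x => (j.succAbove x).succ) (fun p q => hB _ _)
      (fun p q hpq => hBω _ _ (by simpa using (Fin.strictMono_succAbove j) hpq)),
      hBω 0 j.succ (Fin.succ_pos j), Nat.factorial_succ]
    push_cast
    ring

end Wick

/-! ### Conjugation by an exponential -/

section Exponential

open NormedSpace

variable {A : Type*} [NormedRing A] [NormedAlgebra ℂ A] [CompleteSpace A]

theorem exp_mulLeft_apply (x a : A) : exp (ContinuousLinearMap.mul ℂ A x) a = exp x * a := by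
  have h1 := (ContinuousLinearMap.apply ℂ A a).hasSum
    (exp_series_hasSum_exp' (𝕂 := ℂ) (ContinuousLinearMap.mul ℂ A x))
  have h2 := (exp_series_hasSum_exp' (𝕂 := ℂ) x).mul_right a
  have hp : ∀ n : ℕ, ((ContinuousLinearMap.mul ℂ A x) ^ n) a = x ^ n * a := fun n => by
    induction n with
    | zero => simp
    | succ n ih => rw [pow_succ', pow_succ', mul_apply_eq_comp, ih]; simp [mul_assoc]
  simp only [map_smul, ContinuousLinearMap.apply_apply, hp] at h1
  simp only [smul_mul_assoc] at h2
  exact h1.unique h2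

theorem exp_mulRight_apply (x a : A) :
    exp ((ContinuousLinearMap.mul ℂ A).flip x) a = a * exp x := by
  have h1 := (ContinuousLinearMap.apply ℂ A a).hasSum
    (exp_series_hasSum_exp' (𝕂 := ℂ) ((ContinuousLinearMap.mul ℂ A).flip x))
  have h2 := (exp_series_hasSum_exp' (𝕂 := ℂ) x).mul_left a
  have hp : ∀ n : ℕ, (((ContinuousLinearMap.mul ℂ A).flip x) ^ n) a = a * x ^ n := fun n => by
    induction n with
    | zero => simp
    | succ n ih => rw [pow_succ', pow_succ, mul_apply_eq_comp, ih]; simp [mul_assoc]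
  simp only [map_smul, ContinuousLinearMap.apply_apply, hp] at h1
  simp only [mul_smul_comm] at h2
  exact h1.unique h2

/-- A closed subspace stable under the commutator with `x` is stable under conjugation by
`exp x`. -/
theorem exp_mul_mul_exp_neg_mem (V : Submodule ℂ A) (hV : IsClosed (V : Set A)) (x : A)
    (hx : ∀ a ∈ V, x * a - a * x ∈ V) {a : A} (ha : a ∈ V) : exp x * a * exp (-x) ∈ V := by
  let _ := NormedAlgebra.restrictScalars ℚ ℂ (A →L[ℂ] A)
  -- `D` is `ad x`, a sum of commuting left and right multiplications, so `exp D` is conjugation by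
  -- `exp x`.
  set D : A →L[ℂ] A := ContinuousLinearMap.mul ℂ A x + (ContinuousLinearMap.mul ℂ A).flip (-x)
    with hD
  have hcomm : Commute (ContinuousLinearMap.mul ℂ A x) ((ContinuousLinearMap.mul ℂ A).flip (-x)) := by
    ext b; simp [mul_assoc]
  have hexp : exp D a = exp x * a * exp (-x) := by
    rw [hD, exp_add_of_commute hcomm, mul_apply_eq_comp, exp_mulRight_apply,
      exp_mulLeft_apply, mul_assoc]
  have hpow : ∀ n : ℕ, (D ^ n) a ∈ V := fun n => by
    induction n with
    | zero => simpa
    | succ n ih =>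
      rw [pow_succ', mul_apply_eq_comp]
      simpa [hD, sub_eq_add_neg] using hx _ ih
  rw [← hexp]
  have h1 := (ContinuousLinearMap.apply ℂ A a).hasSum (exp_series_hasSum_exp' (𝕂 := ℂ) D)
  exact hV.mem_of_tendsto h1 (Filter.Eventually.of_forall fun s =>
    V.sum_mem fun n _ => by simpa using V.smul_mem _ (hpow n))

end Exponential

/-! ### Trace positivity and the KMS condition -/

section Trace

variable {E : Type*} [NormedAddCommGroup E] [InnerProductSpace ℂ E] [CompleteSpace E]

omit [CompleteSpace E] in
theorem opTrace_mul_comm (A B : E →L[ℂ] E) : opTrace (A * B) = opTrace (B * A) :=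
  LinearMap.trace_mul_comm ℂ _ _

theorem opTrace_star [FiniteDimensional ℂ E] (A : E →L[ℂ] E) :
    opTrace (star A) = conj (opTrace A) := by
  unfold opTrace
  rw [LinearMap.trace_eq_sum_inner _ (stdOrthonormalBasis ℂ E),
    LinearMap.trace_eq_sum_inner _ (stdOrthonormalBasis ℂ E), map_sum]
  refine Finset.sum_congr rfl fun i _ => ?_
  rw [inner_conj_symm]
  exact ContinuousLinearMap.adjoint_inner_right A _ _

/-- The expectation value as a linear functional. -/
noncomputable def expectationLM (ρ : E →L[ℂ] E) : (E →L[ℂ] E) →ₗ[ℂ] ℂ where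
  toFun := expectation ρ
  map_add' A B := by simp [expectation, opTrace, mul_add]
  map_smul' z A := by simp [expectation, opTrace]

theorem expectation_star [FiniteDimensional ℂ E] {ρ : E →L[ℂ] E} (hρ : star ρ = ρ)
    (A : E →L[ℂ] E) : expectation ρ (star A) = conj (expectation ρ A) := by
  unfold expectation
  rw [← opTrace_star, star_mul, hρ, opTrace_mul_comm]

/-- This trace is the squared Hilbert–Schmidt norm. -/
theorem opTrace_star_mul_self_re_pos [FiniteDimensional ℂ E] {A : E →L[ℂ] E} (hA : A ≠ 0) :
    0 < (opTrace (star A * A)).re := by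
  set b := stdOrthonormalBasis ℂ E
  have h : opTrace (star A * A) = ((∑ i, ‖A (b i)‖ ^ 2 : ℝ) : ℂ) := by
    unfold opTrace
    rw [LinearMap.trace_eq_sum_inner _ b, Complex.ofReal_sum]
    refine Finset.sum_congr rfl fun i _ => ?_
    have := ContinuousLinearMap.adjoint_inner_right A (b i) (A (b i))
    rw [inner_self_eq_norm_sq_to_K] at this
    rw [Complex.ofReal_pow]
    exact this
  rw [h, Complex.ofReal_re]
  refine lt_of_le_of_ne (Finset.sum_nonneg fun i _ => by positivity) fun h0 => hA ?_
  rw [eq_comm, Finset.sum_eq_zero_iff_of_nonneg fun i _ => by positivity] at h0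
  have : (A : E →ₗ[ℂ] E) = 0 := b.toBasis.ext fun i => by
    simpa using h0 i (Finset.mem_univ i)
  ext x
  exact LinearMap.congr_fun this x

theorem opTrace_star_mul_self_re_nonneg [FiniteDimensional ℂ E] (A : E →L[ℂ] E) :
    0 ≤ (opTrace (star A * A)).re := by
  by_cases hA : A = 0
  · simp [hA, opTrace]
  · exact (opTrace_star_mul_self_re_pos hA).le

/-- An operator anticommuting with `s ^ 2`, where `s` is self-adjoint and invertible, vanishes. -/
theorem eq_zero_of_anticomm_sq [FiniteDimensional ℂ E] {s t a : E →L[ℂ] E} (hs : star s = s)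
    (hts : t * s = 1) (h : a * (s * s) + s * s * a = 0) : a = 0 := by
  -- Multiply the hypothesis by `star a` and take traces: two squared Hilbert–Schmidt norms, of `a
  -- s` and `s a`, sum to zero.
  have key : opTrace (star (star (a * s)) * star (a * s)) + opTrace (star (s * a) * (s * a)) = 0 := by
    have h2 : star (star (a * s)) * star (a * s) + (s * s * a) * star a = 0 := by
      rw [star_star, star_mul, hs, ← mul_assoc, mul_assoc a s s, ← add_mul, h, zero_mul]
    have h3 : opTrace (star (s * a) * (s * a)) = opTrace (s * s * a * star a) := by
      rw [star_mul, hs, opTrace_mul_comm (s * s * a)]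
      simp only [mul_assoc]
    have h4 := congrArg opTrace h2
    rw [h3]
    simpa [opTrace] using h4
  by_contra ha
  have hsa : s * a ≠ 0 := fun h0 => ha (by rw [← one_mul a, ← hts, mul_assoc, h0, mul_zero])
  have h5 := congrArg Complex.re key
  rw [Complex.add_re, Complex.zero_re] at h5
  linarith [opTrace_star_mul_self_re_nonneg (star (a * s)), opTrace_star_mul_self_re_pos hsa]

/-- The Kubo–Martin–Schwinger condition for `exp (-H)`, on a subspace stable under the commutator
with `H`, in a form suited to Wick's recursion. -/
theorem exists_kms_decomposition [FiniteDimensional ℂ E] (V : Submodule ℂ (E →L[ℂ] E))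
    [FiniteDimensional ℂ V] {H : E →L[ℂ] E} (hH : star H = H) (hV : ∀ a ∈ V, H * a - a * H ∈ V)
    {a : E →L[ℂ] E} (ha : a ∈ V) :
    ∃ d ∈ V, ∃ d', d + d' = a ∧ ∀ x, opTrace (NormedSpace.exp (-H) * (x * d)) =
      opTrace (NormedSpace.exp (-H) * (d' * x)) := by
  let _ := NormedAlgebra.restrictScalars ℚ ℂ (E →L[ℂ] E)
  have hinv : ∀ x : E →L[ℂ] E, NormedSpace.exp x * NormedSpace.exp (-x) = 1 := fun x => by
    rw [← NormedSpace.exp_add_of_commute (Commute.refl x).neg_right]; simp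
  set s : E →L[ℂ] E := NormedSpace.exp ((-(1 / 2) : ℂ) • H) with hs
  have hss : s * s = NormedSpace.exp (-H) := by
    rw [hs, ← NormedSpace.exp_add_of_commute (Commute.refl _), ← add_smul]; norm_num
  have hsa : star s = s := by
    rw [hs, NormedSpace.star_exp, star_smul, hH]; simp
  have hts : NormedSpace.exp (-((-(1 / 2) : ℂ) • H)) * s = 1 := by
    have := hinv (-((-(1 / 2) : ℂ) • H))
    rwa [neg_neg] at this
  have hR : NormedSpace.exp (-H) * NormedSpace.exp H = 1 := by
    have := hinv (-H)
    rwa [neg_neg] at this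
  let f : (E →L[ℂ] E) →ₗ[ℂ] (E →L[ℂ] E) := LinearMap.id +
    (LinearMap.mulRight ℂ (NormedSpace.exp (-H))).comp (LinearMap.mulLeft ℂ (NormedSpace.exp H))
  have hf : ∀ x, f x = x + NormedSpace.exp H * x * NormedSpace.exp (-H) := fun x => rfl
  have hfV : ∀ x ∈ V, f x ∈ V := fun x hx => V.add_mem hx
    (exp_mul_mul_exp_neg_mem V V.closed_of_finiteDimensional H hV hx)
  -- A kernel element anticommutes with `exp (-H) = s * s`, hence vanishes. Finite dimension turns
  -- injectivity into solvability of `f d = a`.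
  have hinj : Function.Injective (f.restrict hfV) := by
    rw [← LinearMap.ker_eq_bot, LinearMap.ker_eq_bot']
    rintro ⟨x, hx⟩ h0
    have h0' : f x = 0 := congrArg Subtype.val h0
    rw [hf] at h0'
    have : x = 0 := eq_zero_of_anticomm_sq hsa hts (by
      have h1 := congrArg (NormedSpace.exp (-H) * ·) h0'
      simp only [mul_add, ← mul_assoc, hR, one_mul, mul_zero] at h1
      rw [hss, add_comm, h1])
    simpa using this
  obtain ⟨⟨d, hd⟩, hda⟩ := LinearMap.injective_iff_surjective.mp hinj ⟨a, ha⟩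
  refine ⟨d, hd, NormedSpace.exp H * d * NormedSpace.exp (-H), congrArg Subtype.val hda,
    fun x => ?_⟩
  rw [← mul_assoc, opTrace_mul_comm]
  simp only [← mul_assoc, hR, one_mul]

end Trace

/-! ### Fermionic fields and the Bogoliubov–de Gennes Gibbs state -/

section QuasiFree

variable {E : Type*} [NormedAddCommGroup E] [InnerProductSpace ℂ E] [CompleteSpace E] {N : ℕ}

/-- The span of the annihilation and creation operators. -/
def fieldSpace (c : Fin N → (E →L[ℂ] E)) : Submodule ℂ (E →L[ℂ] E) :=
  Submodule.span ℂ (Set.range c ∪ Set.range fun i => star (c i))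

theorem annihilation_mem_fieldSpace (c : Fin N → (E →L[ℂ] E)) (i : Fin N) :
    c i ∈ fieldSpace c :=
  Submodule.subset_span (Or.inl ⟨i, rfl⟩)

theorem creation_mem_fieldSpace (c : Fin N → (E →L[ℂ] E)) (i : Fin N) :
    star (c i) ∈ fieldSpace c :=
  Submodule.subset_span (Or.inr ⟨i, rfl⟩)

theorem IsCAR.exists_anticomm {c : Fin N → (E →L[ℂ] E)} (hc : IsCAR c) {a b : E →L[ℂ] E}
    (ha : a ∈ fieldSpace c) (hb : b ∈ fieldSpace c) :
    ∃ z : ℂ, a * b + b * a = z • (1 : E →L[ℂ] E) := by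
  have hdelta : ∀ i j : Fin N, ∃ z : ℂ,
      (if i = j then 1 else 0 : E →L[ℂ] E) = z • (1 : E →L[ℂ] E) := fun i j =>
    ⟨if i = j then 1 else 0, by split_ifs <;> simp⟩
  refine Submodule.span_induction₂ (p := fun a b _ _ =>
    ∃ z : ℂ, a * b + b * a = z • (1 : E →L[ℂ] E)) ?_ ?_ ?_ ?_ ?_ ?_ ?_ ha hb
  · rintro _ _ (⟨i, rfl⟩ | ⟨i, rfl⟩) (⟨j, rfl⟩ | ⟨j, rfl⟩)
    · exact ⟨0, by rw [hc.annihilation, zero_smul]⟩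
    · exact (hdelta i j).imp fun z hz => by rw [← hz, ← hc.mixed]
    · exact (hdelta j i).imp fun z hz => by rw [← hz, ← hc.mixed, add_comm]
    · exact ⟨0, by simp only [hc.creation, zero_smul]⟩
  · exact fun _ _ => ⟨0, by simp⟩
  · exact fun _ _ => ⟨0, by simp⟩
  · rintro x y b _ _ _ ⟨z, hz⟩ ⟨w, hw⟩
    exact ⟨z + w, by rw [add_smul, ← hz, ← hw]; noncomm_ring⟩
  · rintro b x y _ _ _ ⟨z, hz⟩ ⟨w, hw⟩
    exact ⟨z + w, by rw [add_smul, ← hz, ← hw]; noncomm_ring⟩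
  · rintro r x y _ _ ⟨z, hz⟩
    exact ⟨r * z, by rw [mul_smul, ← hz, smul_add, smul_mul_assoc, mul_smul_comm]⟩
  · rintro r x y _ _ ⟨z, hz⟩
    exact ⟨r * z, by rw [mul_smul, ← hz, smul_add, smul_mul_assoc, mul_smul_comm]⟩

/-- The operators whose commutator preserves a subspace. -/
def commutatorStabilizer {A : Type*} [Ring A] [Algebra ℂ A] (V : Submodule ℂ A) :
    Submodule ℂ A where
  carrier := {x | ∀ a ∈ V, x * a - a * x ∈ V}
  add_mem' {x y} hx hy a ha := by
    have := V.add_mem (hx a ha) (hy a ha)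
    rwa [show x * a - a * x + (y * a - a * y) = (x + y) * a - a * (x + y) by noncomm_ring] at this
  zero_mem' a _ := by simp
  smul_mem' z x hx a ha := by
    have := V.smul_mem z (hx a ha)
    rwa [smul_sub, ← smul_mul_assoc, ← mul_smul_comm] at this

/-- `[xy, a] = x{y, a} - {x, a}y`, and both anticommutators are scalars. -/
theorem IsCAR.mul_mem_commutatorStabilizer {c : Fin N → (E →L[ℂ] E)} (hc : IsCAR c)
    {x y : E →L[ℂ] E} (hx : x ∈ fieldSpace c) (hy : y ∈ fieldSpace c) :
    x * y ∈ commutatorStabilizer (fieldSpace c) := by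
  intro a ha
  obtain ⟨z, hz⟩ := hc.exists_anticomm hy ha
  obtain ⟨w, hw⟩ := hc.exists_anticomm hx ha
  have : x * y * a - a * (x * y) = z • x - w • y := by
    calc x * y * a - a * (x * y) = x * (y * a + a * y) - (x * a + a * x) * y := by noncomm_ring
      _ = z • x - w • y := by rw [hz, hw]; simp
  rw [this]
  exact Submodule.sub_mem _ (Submodule.smul_mem _ _ hx) (Submodule.smul_mem _ _ hy)

theorem IsCAR.bdgHamiltonian_mem_commutatorStabilizer {c : Fin N → (E →L[ℂ] E)} (hc : IsCAR c)
    (M Δ : Matrix (Fin N) (Fin N) ℂ) :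
    bdgHamiltonian c M Δ ∈ commutatorStabilizer (fieldSpace c) := by
  have ha := annihilation_mem_fieldSpace c
  have hs := creation_mem_fieldSpace c
  refine Submodule.add_mem _ (Submodule.smul_mem _ _ ?_) (Submodule.smul_mem _ _ ?_) <;>
    refine Submodule.sum_mem _ fun i _ => Submodule.sum_mem _ fun j _ => ?_
  · exact Submodule.smul_mem _ _ (Submodule.sub_mem _
      (hc.mul_mem_commutatorStabilizer (hs i) (ha j))
      (hc.mul_mem_commutatorStabilizer (ha j) (hs i)))
  · exact Submodule.sub_mem _
      (Submodule.smul_mem _ _ (hc.mul_mem_commutatorStabilizer (hs i) (hs j)))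
      (Submodule.smul_mem _ _ (hc.mul_mem_commutatorStabilizer (ha i) (ha j)))

theorem star_bdgHamiltonian (c : Fin N → (E →L[ℂ] E)) {M Δ : Matrix (Fin N) (Fin N) ℂ}
    (hM : M.IsHermitian) (hc : IsCAR c) :
    star (bdgHamiltonian c M Δ) = bdgHamiltonian c M Δ := by
  have hMij : ∀ i j, conj (M i j) = M j i := fun i j => hM.apply j i
  unfold bdgHamiltonian
  simp only [star_add, star_sum, star_smul, star_sub, star_mul, star_star]
  congr 2
  · simp
  · rw [Finset.sum_comm]
    simp only [RCLike.star_def, hMij]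
  · simp
  · refine Finset.sum_congr rfl fun i _ => Finset.sum_congr rfl fun j _ => ?_
    have h1 := eq_neg_of_add_eq_zero_left (hc.annihilation j i)
    have h2 := eq_neg_of_add_eq_zero_left (hc.creation j i)
    rw [h1, h2]
    simp [sub_eq_add_neg, add_comm]

omit [CompleteSpace E] in
theorem expectation_one {ρ : E →L[ℂ] E} : expectation ρ 1 = opTrace ρ := by
  rw [expectation, mul_one]

/-- The Gibbs state of a self-adjoint operator is self-adjoint. -/
theorem star_thermalState [FiniteDimensional ℂ E] (β : ℝ) {H : E →L[ℂ] E} (hH : star H = H) :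
    star (thermalState β H) = thermalState β H := by
  have he : star (NormedSpace.exp ((-β : ℂ) • H)) = NormedSpace.exp ((-β : ℂ) • H) := by
    rw [NormedSpace.star_exp, star_smul, hH]; simp
  unfold thermalState
  rw [star_smul, he, star_inv₀, RCLike.star_def, ← opTrace_star, he]

theorem opTrace_exp_ne_zero [FiniteDimensional ℂ E] [Nontrivial E] {H : E →L[ℂ] E}
    (hH : star H = H) : opTrace (NormedSpace.exp H) ≠ 0 := by
  let _ := NormedAlgebra.restrictScalars ℚ ℂ (E →L[ℂ] E)
  set s : E →L[ℂ] E := NormedSpace.exp ((1 / 2 : ℂ) • H) with hs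
  have hss : star s * s = NormedSpace.exp H := by
    have : star s = s := by rw [hs, NormedSpace.star_exp, star_smul, hH]; simp
    rw [this, hs, ← NormedSpace.exp_add_of_commute (Commute.refl _), ← add_smul]; norm_num
  have hs0 : s ≠ 0 := (NormedSpace.isUnit_exp _).ne_zero
  intro h
  have := opTrace_star_mul_self_re_pos hs0
  rw [hss, h] at this
  simp at this

theorem opTrace_thermalState [FiniteDimensional ℂ E] [Nontrivial E] (β : ℝ) {H : E →L[ℂ] E}
    (hH : star H = H) : opTrace (thermalState β H) = 1 := by
  have h := opTrace_exp_ne_zero (H := (-β : ℂ) • H) (by rw [star_smul, hH]; simp)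
  unfold thermalState
  conv_lhs => unfold opTrace
  simp only [ContinuousLinearMap.toLinearMap_smul, map_smul, smul_eq_mul]
  exact inv_mul_cancel₀ h

theorem expectation_thermalState [FiniteDimensional ℂ E] (β : ℝ) (H x : E →L[ℂ] E) :
    expectation (thermalState β H) x = (opTrace (NormedSpace.exp ((-β : ℂ) • H)))⁻¹ *
      opTrace (NormedSpace.exp ((-β : ℂ) • H) * x) := by
  simp [expectation, thermalState, opTrace]

/-- Wick's theorem for the Bogoliubov–de Gennes Gibbs state. -/
theorem IsCAR.pfaffianSum_eq_expectation [FiniteDimensional ℂ E] [Nontrivial E]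
    {c : Fin N → (E →L[ℂ] E)} (hc : IsCAR c) {M Δ : Matrix (Fin N) (Fin N) ℂ}
    (hM : M.IsHermitian) (β : ℝ) {k n : ℕ} (h : n = k * 2)
    (b : Fin n → (E →L[ℂ] E)) (hb : ∀ p, b p ∈ fieldSpace c) (B : Matrix (Fin n) (Fin n) ℂ)
    (hB : ∀ p q, B q p = -B p q)
    (hBb : ∀ p q, p < q →
      B p q = expectation (thermalState β (bdgHamiltonian c M Δ)) (b p * b q)) :
    pfaffianSum h B = (2 ^ k * k ! : ℂ) *
      expectation (thermalState β (bdgHamiltonian c M Δ)) (List.ofFn b).prod := by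
  classical
  set H := bdgHamiltonian c M Δ
  have hH : star H = H := star_bdgHamiltonian c hM hc
  -- Membership goes under the existential so that `g` becomes a total function of two operators.
  have hcomm : ∀ a b, ∃ z : ℂ, a ∈ fieldSpace c → b ∈ fieldSpace c →
      a * b + b * a = z • (1 : E →L[ℂ] E) := fun a b => by
    by_cases hab : a ∈ fieldSpace c ∧ b ∈ fieldSpace c
    · exact (hc.exists_anticomm hab.1 hab.2).imp fun z hz _ _ => hz
    · exact ⟨0, fun h1 h2 => absurd ⟨h1, h2⟩ hab⟩
  choose g hg using hcomm
  have : FiniteDimensional ℂ (fieldSpace c) :=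
    FiniteDimensional.span_of_finite ℂ (Set.toFinite _)
  have h1 : expectationLM (thermalState β H) 1 = 1 :=
    expectation_one.trans (opTrace_thermalState β hH)
  refine pfaffianSum_eq_of_wick (fieldSpace c : Set (E →L[ℂ] E)) (expectationLM (thermalState β H))
    h1 (fun a ha m b hm hb => wick_recursion _ g (fun a ha b hb => hg a b ha hb) _ h1
      (fun a ha => ?_) ha hm b hb) k n h b hb B hB hBb
  have hβH : (β : ℂ) • H ∈ commutatorStabilizer (fieldSpace c) :=
    Submodule.smul_mem _ _ (hc.bdgHamiltonian_mem_commutatorStabilizer M Δ)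
  obtain ⟨d, hd, d', hdd, htr⟩ := exists_kms_decomposition (fieldSpace c) (H := (β : ℂ) • H)
    (by rw [star_smul, hH]; simp) hβH ha
  refine ⟨d, hd, d', hdd, fun x => ?_⟩
  change expectation _ _ = expectation _ _
  rw [expectation_thermalState, expectation_thermalState, neg_smul, htr]

theorem IsCAR.matP_antisymm {c : Fin N → (E →L[ℂ] E)} (hc : IsCAR c) (ρ : E →L[ℂ] E)
    (i j : Fin N) : matP ρ c j i = -matP ρ c i j := by
  change expectationLM ρ _ = -expectationLM ρ _
  rw [eq_neg_of_add_eq_zero_left (hc.creation j i), map_neg]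

theorem IsCAR.pfKernel_transpose {c : Fin N → (E →L[ℂ] E)} (hc : IsCAR c) (ρ : E →L[ℂ] E)
    (i j : Fin N) : (pfKernel ρ c i j)ᵀ = -pfKernel ρ c j i := by
  ext r s
  fin_cases r <;> fin_cases s <;> simp [pfKernel, hc.matP_antisymm ρ i j]

/-- For distinct modes, the kernel collects the two-point functions. -/
theorem IsCAR.pfKernel_apply_of_ne [FiniteDimensional ℂ E] {c : Fin N → (E →L[ℂ] E)} (hc : IsCAR c)
    {ρ : E →L[ℂ] E} (hρ : star ρ = ρ) {i j : Fin N} (hij : i ≠ j) (r s : Fin 2) :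
    pfKernel ρ c i j r s =
      expectation ρ (![star (c i), c i] r * ![star (c j), c j] s) := by
  fin_cases r <;> fin_cases s
  · rfl
  · rfl
  · change -expectationLM ρ _ = expectationLM ρ _
    have := hc.mixed i j
    rw [if_neg hij] at this
    rw [← map_neg]
    exact congrArg _ (eq_neg_of_add_eq_zero_left this).symm
  · change -conj (matP ρ c i j) = expectation ρ (c i * c j)
    rw [← map_neg, ← hc.matP_antisymm]
    change conj (expectation ρ _) = _
    rw [← expectation_star hρ]
    simp

end QuasiFree

theorem mainTheorem4 {N : ℕ} {E : Type*} [NormedAddCommGroup E] [InnerProductSpace ℂ E]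
    [CompleteSpace E] [FiniteDimensional ℂ E] [Nontrivial E]
    (c : Fin N → (E →L[ℂ] E)) (hc : IsCAR c)
    (M Δ : Matrix (Fin N) (Fin N) ℂ) (hM : M.IsHermitian) (hΔ : Δᵀ = -Δ)
    (β : ℝ) (hβ : 0 < β)
    (ρ : E →L[ℂ] E) (hρ : ρ = thermalState β (bdgHamiltonian c M Δ)) :
    (∀ (k : ℕ) (i : Fin k → Fin N), Function.Injective i →
      expectation ρ (List.ofFn fun m => numberOp c (i m)).prod =
        pfaffian (blockMatrix fun m n => pfKernel ρ c (i m) (i n))) ∧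
    (∀ i j : Fin N, (pfKernel ρ c i j)ᵀ = -pfKernel ρ c j i) := by
  refine ⟨fun k i hi => ?_, hc.pfKernel_transpose ρ⟩
  have hρs : star ρ = ρ := hρ ▸ star_thermalState β (star_bdgHamiltonian c hM hc)
  have hprod : (List.ofFn fun m => numberOp c (i m)).prod = (List.ofFn fun p : Fin (k * 2) =>
      ![star (c (i p.divNat)), c (i p.divNat)] p.modNat).prod := by
    rw [List.ofFn_mul, List.prod_flatten, List.map_ofFn]
    congr 2
    ext1 m
    have h0 : ∀ (r : Fin 2) (h : (m : ℕ) * 2 + r < k * 2),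
        (⟨m * 2 + r, h⟩ : Fin (k * 2)).divNat = m ∧
        (⟨m * 2 + r, h⟩ : Fin (k * 2)).modNat = r := fun r h => by
      constructor <;> ext <;> simp only [Fin.coe_divNat, Fin.coe_modNat] <;> omega
    rw [Function.comp_apply]
    simp only [h0]
    simp [numberOp, List.ofFn_succ]
  rw [pfaffian_eq_pfaffianSum, hprod, hρ,
    hc.pfaffianSum_eq_expectation hM β rfl (fun p : Fin (k * 2) =>
      ![star (c (i p.divNat)), c (i p.divNat)] p.modNat)]
  · rw [inv_mul_cancel_left₀]
    exact mul_ne_zero (by simp) (Nat.cast_ne_zero.mpr (Nat.factorial_ne_zero k))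
  · intro p
    generalize p.modNat = r
    fin_cases r
    · exact creation_mem_fieldSpace c _
    · exact annihilation_mem_fieldSpace c _
  · intro p q
    have := congrFun (congrFun (hc.pfKernel_transpose ρ (i p.divNat) (i q.divNat)) q.modNat) p.modNat
    rw [← hρ]
    simp only [blockMatrix, Matrix.of_apply]
    rw [Matrix.transpose_apply] at this
    rw [this, Matrix.neg_apply, neg_neg]
  · intro p q hpq
    rw [← hρ]
    simp only [blockMatrix, Matrix.of_apply]
    -- Inside a diagonal block, `p < q` leaves only the entry `K_ii = ⟨c_i^* c_i⟩`. Across blocks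
    -- the modes are distinct by injectivity, so all four entries are two-point functions.
    by_cases hd : p.divNat = q.divNat
    · have hr : p.modNat = 0 ∧ q.modNat = 1 := by
        rw [Fin.ext_iff] at hd
        rw [Fin.lt_def] at hpq
        simp only [Fin.ext_iff, Fin.val_zero, Fin.val_one, Fin.coe_divNat, Fin.coe_modNat] at hd ⊢
        omega
      rw [hr.1, hr.2, hd]
      rfl
    · exact hc.pfKernel_apply_of_ne hρs (fun h => hd (hi h)) _ _
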